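/- Let $G$ be a graph. The density of a pair $(A,B)$ of disjoint non-empty sets of vertices is $d_G(A,B)=\frac{e_G(A,B)}{|A||B|}$, where $e_G(A,B)$ is the number of edges between $A$ and $B$. For $\varepsilon>0$ the pair $(A,B)_G$ is called $\varepsilon$-regular if $|d_G(A,B)-d_G(X,Y)|\le\varepsilon$ for all $X\subseteq A$ and $Y\subseteq B$ with $|X|\ge\varepsilon|A|$ and $|Y|\ge\varepsilon|B|$. In the $(1:1)$ Maker-Breaker game on $E(G)$, Maker and Breaker alternately claim one unclaimed edge of $G$ each, until all edges are claimed. **Lemma.** For all reals $0<\varepsilon<\alpha<1$ with $\alpha>8\varepsilon$ there is an $n_0$ such that the following holds for every $n\ge n_0$. Let $G=(A\cup B,E)$ be a bipartite graph with parts $A,B$ of size $|A|=|B|=n$ such that $(A,B)_G$ is $\varepsilon$-regular and has density $\alpha$. Then, no matter which player starts, Maker has a strategy in the $(1:1)$ Maker-Breaker game on $E(G)$ which ensures that the graph $\mathcal M\subseteq G$ of all edges that she has claimed by the end of the game is such that $(A,B)_{\mathcal M}$ is $4\varepsilon$-regular and has density $\frac{\alpha}{2}$ up to the rounding that is unavoidable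 when $|E|$ is odd: if $|E|$ is even, then $d_{\mathcal M}(A,B)=\frac{\alpha}{2}$; in every case $\left|d_{\mathcal M}(A,B)-\frac{\alpha}{2}\right|\le\frac{1}{2n^2}$ (that is, Maker claims $\lfloor |E|/2\rfloor$ or $\lceil |E|/2\rceil$ edges); and if Maker starts, then $d_{\mathcal M}(A,B)\ge\frac{\alpha}{2}$. -/

import Mathlib

/-! ### The unbiased Maker-Breaker game on a finite board -/

/-- The two players of a Maker-Breaker game. -/
inductive MBPlayer : Type
  | maker : MBPlayer
  | breaker : MBPlayer

namespace MBPlayer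

/-- The opponent of a player. -/
def other : MBPlayer → MBPlayer
  | maker => breaker
  | breaker => maker

/-- The player who makes the move number `i` (counted from `0`) of a `(1:1)` game, if the player
`first` starts the game: the players alternate. -/
def turn (first : MBPlayer) : ℕ → MBPlayer
  | 0 => first
  | i + 1 => (turn first i).other

end MBPlayer

namespace MakerBreaker

variable {E : Type*}

/-- The list of the elements claimed so far (by both players, in the order in which they were
claimed) at some moment of a game on the board `X`: players claim elements of the board, and no
element is claimed twice. -/
def IsHistory (X : Finset E) (h : List E) : Prop :=
  h.Nodup ∧ ∀ e ∈ h, e ∈ X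

/-- A complete play on the board `X`: a history in which every element has been claimed. -/
def IsCompletePlay (X : Finset E) (p : List E) : Prop :=
  IsHistory X p ∧ ∀ e ∈ X, e ∈ p

/-- `σ` (which maps the history to the next element to be claimed) is a strategy for Maker: whenever
it is her turn and there are free elements, it tells her to claim a free element of the board. -/
def IsMakerStrategy (X : Finset E) (first : MBPlayer) (σ : List E → E) : Prop :=
  ∀ h : List E, IsHistory X h → h.length < X.card →
    first.turn h.length = MBPlayer.maker → σ h ∈ X ∧ σ h ∉ h

/-- In the play `p`, Maker has made all her moves according to `σ`. -/
def FollowsMaker (first : MBPlayer) (σ : List E → E) (p : List E) : Prop :=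
  ∀ (i : ℕ) (hi : i < p.length), first.turn i = MBPlayer.maker → p[i] = σ (p.take i)

/-- The set of the elements that Maker has claimed in the play `p`. -/
def makerSet (first : MBPlayer) (p : List E) : Set E :=
  {e | ∃ i : ℕ, first.turn i = MBPlayer.maker ∧ p[i]? = some e}

/-- In the `(1:1)` Maker-Breaker game on the board `X` started by the player `first`, Maker has a
strategy such that, however Breaker plays, the set of all elements that she has claimed by the
end of the game has the property `P`. -/
def MakerCanEnsure (X : Finset E) (first : MBPlayer) (P : Set E → Prop) : Prop :=
  ∃ σ : List E → E, IsMakerStrategy X first σ ∧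
    ∀ p : List E, IsCompletePlay X p → FollowsMaker first σ p → P (makerSet first p)

end MakerBreaker

/-! ### Regular pairs -/

namespace RegularPair

open Classical in
/-- The density `d_G(A,B) = e_G(A,B) / (|A||B|)` of a pair of disjoint sets of vertices, as a real
number. -/
noncomputable def density {V : Type*} (G : SimpleGraph V) (A B : Finset V) : ℝ :=
  (G.edgeDensity A B : ℝ)

/-- The pair `(A,B)` is `ε`-regular in `G`. (Mathlib's `SimpleGraph.IsUniform` is the variant with
a strict inequality at the end.) -/
def IsEpsRegular {V : Type*} (G : SimpleGraph V) (ε : ℝ) (A B : Finset V) : Prop :=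
  ∀ X ⊆ A, ∀ Y ⊆ B, ε * (A.card : ℝ) ≤ (X.card : ℝ) → ε * (B.card : ℝ) ≤ (Y.card : ℝ) →
    |density G A B - density G X Y| ≤ ε

end RegularPair

/-! Maker plays a derandomised version of splitting `G` at random. For a small `r`, each edge set
between a pair `(X, Y)` receives two products over the claimed edges it contains: factors `1 + r`
for Maker and `1 - r` for Breaker, and the reverse. The potential is the sum of all these products.
Maker claims the edge that makes it grow least, so a round of her move and Breaker's reply never
raises it (`potential_append_append_le`), and at most two moves of the play stay unpaired. At the
end every single product is at most the potential. By `exp_sub_sq_le` this bounds each discrepancy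
by `log (8 * #pairs) / r + r * |E|` (`makerCanEnsure_discrepancy`). There are only `2 ^ (4 * n)`
pairs, so the logarithm is linear in `n`. With `r = 8 * ε ^ 3`, densities on large pairs are halved
up to `ε`, and regularity follows by the triangle inequality. The exact density is forced by
alternation alone. -/

namespace MBPlayer

/-- The sign of a player: `1` for Maker, `-1` for Breaker. -/
def sign : MBPlayer → ℝ
  | maker => 1
  | breaker => -1

theorem turn_other (q : MBPlayer) (i : ℕ) : q.other.turn i = q.turn (i + 1) := by
  induction i with
  | zero => rfl
  | succ i ih => rw [turn, ih]; rfl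

end MBPlayer

/-! ### Weights of plays -/

namespace MakerBreaker

variable {E : Type*}

/-- The product of the factors `1 + c e` over the elements `e` claimed by Maker and `1 - c e` over
those claimed by Breaker. -/
noncomputable def weight (c : E → ℝ) : MBPlayer → List E → ℝ
  | _, [] => 1
  | q, e :: t => (1 + q.sign * c e) * weight c q.other t

theorem weight_append_singleton (c : E → ℝ) (q : MBPlayer) (l : List E) (e : E) :
    weight c q (l ++ [e]) = weight c q l * (1 + (q.turn l.length).sign * c e) := by
  induction l generalizing q with
  | nil => simp [weight, MBPlayer.turn]
  | cons a t ih =>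
    rw [List.cons_append, weight, ih, weight, MBPlayer.turn_other, List.length_cons, mul_assoc]

theorem sign_mul_le (q : MBPlayer) {x r : ℝ} (hx : |x| ≤ r) : |q.sign * x| ≤ r := by
  cases q <;> simpa [MBPlayer.sign] using hx

theorem weight_nonneg {c : E → ℝ} (hc : ∀ e, |c e| ≤ 1) (q : MBPlayer) (l : List E) :
    0 ≤ weight c q l := by
  induction l generalizing q with
  | nil => simp [weight]
  | cons a t ih =>
    have h := abs_le.mp (sign_mul_le q (hc a))
    exact mul_nonneg (by linarith) (ih _)

theorem mem_makerSet_cons (q : MBPlayer) (a : E) (t : List E) (e : E) :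
    e ∈ makerSet q (a :: t) ↔ (q = MBPlayer.maker ∧ e = a) ∨ e ∈ makerSet q.other t := by
  constructor
  · rintro ⟨i, hi, he⟩
    cases i with
    | zero => exact Or.inl ⟨hi, by simpa [eq_comm] using he⟩
    | succ i => exact Or.inr ⟨i, by rwa [MBPlayer.turn_other], by simpa using he⟩
  · rintro (⟨hq, rfl⟩ | ⟨i, hi, he⟩)
    · exact ⟨0, hq, by simp⟩
    · exact ⟨i + 1, by rwa [← MBPlayer.turn_other], by simpa using he⟩

theorem mem_of_mem_makerSet {q : MBPlayer} {l : List E} {e : E} (h : e ∈ makerSet q l) :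
    e ∈ l := by
  obtain ⟨i, -, he⟩ := h
  exact List.mem_of_getElem? he

open Classical in
theorem weight_eq_prod (c : E → ℝ) (q : MBPlayer) (l : List E) (hl : l.Nodup) :
    weight c q l = ∏ e ∈ l.toFinset, (1 + (if e ∈ makerSet q l then 1 else -1) * c e) := by
  induction l generalizing q with
  | nil => simp [weight]
  | cons a t ih =>
    rw [List.nodup_cons] at hl
    have ha : a ∉ makerSet q.other t := fun h => hl.1 (mem_of_mem_makerSet h)
    rw [weight, List.toFinset_cons, Finset.prod_insert (by simpa using hl.1), ih _ hl.2]
    congr 1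
    · cases q <;> simp [mem_makerSet_cons, ha, MBPlayer.sign]
    · refine Finset.prod_congr rfl fun e he => ?_
      have hea : e ≠ a := by
        rintro rfl
        exact hl.1 (by simpa using he)
      simp [mem_makerSet_cons, hea]

open Classical in
theorem card_filter_makerSet (q : MBPlayer) (l : List E) (hl : l.Nodup) :
    (l.toFinset.filter (· ∈ makerSet q l)).card =
      (l.length + if q = MBPlayer.maker then 1 else 0) / 2 := by
  induction l generalizing q with
  | nil => cases q <;> simp
  | cons a t ih =>
    rw [List.nodup_cons] at hl
    have ha : a ∉ makerSet q.other t := fun h => hl.1 (mem_of_mem_makerSet h)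
    have ht : t.toFinset.filter (· ∈ makerSet q (a :: t)) =
        t.toFinset.filter (· ∈ makerSet q.other t) := by
      refine Finset.filter_congr fun e he => ?_
      have hea : e ≠ a := by
        rintro rfl
        exact hl.1 (by simpa using he)
      simp [mem_makerSet_cons, hea]
    rw [List.toFinset_cons, Finset.filter_insert, ht]
    have hi := ih q.other hl.2
    cases q
    · rw [if_pos (by simp [mem_makerSet_cons]), Finset.card_insert_of_notMem (by simp [hl.1]), hi]
      simp [MBPlayer.other]
      omega
    · rw [if_neg (by simpa [mem_makerSet_cons] using ha), hi]
      simp [MBPlayer.other]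

/-! ### The potential strategy -/

section Potential

variable {κ : Type*} [Fintype κ]

/-- The sum of the weights of a history over a family of functions. -/
noncomputable def potential (c : κ → E → ℝ) (q : MBPlayer) (l : List E) : ℝ :=
  ∑ k, weight (c k) q l

/-- The rate at which the potential grows if Maker claims `e`. -/
noncomputable def gain (c : κ → E → ℝ) (q : MBPlayer) (l : List E) (e : E) : ℝ :=
  ∑ k, weight (c k) q l * c k e

theorem potential_append_le {c : κ → E → ℝ} {r : ℝ} (hr : r ≤ 1) (hc : ∀ k e, |c k e| ≤ r)
    (q : MBPlayer) (l : List E) (e : E) :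
    potential c q (l ++ [e]) ≤ (1 + r) * potential c q l := by
  rw [potential, potential, Finset.mul_sum]
  refine Finset.sum_le_sum fun k _ => ?_
  rw [weight_append_singleton, mul_comm]
  refine mul_le_mul_of_nonneg_right ?_ (weight_nonneg (fun e => (hc k e).trans hr) _ _)
  linarith [(abs_le.mp (sign_mul_le (q.turn l.length) (hc k e))).2]

/-- The two factors expand as `(1 + c e) * (1 - c f) = 1 + c e - c f - c e * c f`. The linear terms
sum to a difference of gains, and the quadratic one only helps. -/
theorem potential_append_append_le {c : κ → E → ℝ} (hc : ∀ k e, |c k e| ≤ 1)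
    (hcc : ∀ k e f, 0 ≤ c k e * c k f) {q : MBPlayer} {l : List E} {e f : E}
    (hq : q.turn l.length = MBPlayer.maker) (hef : gain c q l e ≤ gain c q l f) :
    potential c q (l ++ [e] ++ [f]) ≤ potential c q l := by
  have hq' : q.turn (l ++ [e]).length = MBPlayer.breaker := by
    simp [MBPlayer.turn, hq, MBPlayer.other]
  have h : potential c q (l ++ [e] ++ [f]) = potential c q l + gain c q l e - gain c q l f -
      ∑ k, weight (c k) q l * (c k e * c k f) := by
    simp only [potential, gain]
    rw [← Finset.sum_add_distrib, ← Finset.sum_sub_distrib, ← Finset.sum_sub_distrib]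
    refine Finset.sum_congr rfl fun k _ => ?_
    rw [weight_append_singleton, hq', weight_append_singleton, hq]
    simp only [MBPlayer.sign]
    ring
  have h0 : 0 ≤ ∑ k, weight (c k) q l * (c k e * c k f) :=
    Finset.sum_nonneg fun k _ => mul_nonneg (weight_nonneg (hc k) _ _) (hcc k e f)
  linarith

/-- The conditional form lets a total strategy be chosen, with junk values on full boards. -/
theorem exists_minimal_gain [Nonempty E] (X : Finset E) (c : κ → E → ℝ) (q : MBPlayer)
    (h : List E) : ∃ e : E, (∃ x ∈ X, x ∉ h) →
      e ∈ X ∧ e ∉ h ∧ ∀ f ∈ X, f ∉ h → gain c q h e ≤ gain c q h f := by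
  classical
  by_cases hx : ∃ x ∈ X, x ∉ h
  · obtain ⟨x, hxX, hxh⟩ := hx
    obtain ⟨e, he, hmin⟩ := (X.filter (· ∉ h)).exists_min_image (gain c q h)
      ⟨x, by simp [hxX, hxh]⟩
    simp only [Finset.mem_filter] at he hmin
    exact ⟨e, fun _ => ⟨he.1, he.2, fun f hf hfh => hmin f ⟨hf, hfh⟩⟩⟩
  · exact ⟨Classical.arbitrary E, fun h' => absurd h' hx⟩

theorem exists_mem_notMem {X : Finset E} {h : List E} (hlt : h.length < X.card) :
    ∃ x ∈ X, x ∉ h := by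
  classical
  by_contra! hX
  have : X ⊆ h.toFinset := fun x hx => by simpa using hX x hx
  exact absurd ((Finset.card_le_card this).trans (List.toFinset_card_le h)) (by omega)

/-- Maker can keep the potential bounded by always claiming an element of minimal gain. -/
theorem makerCanEnsure_potential_le [Nonempty E] (X : Finset E) (q : MBPlayer) {c : κ → E → ℝ}
    {r : ℝ} (hr0 : 0 ≤ r) (hr : r ≤ 1) (hc : ∀ k e, |c k e| ≤ r)
    (hcc : ∀ k e f, 0 ≤ c k e * c k f) :
    ∃ σ : List E → E, IsMakerStrategy X q σ ∧ ∀ p : List E, IsCompletePlay X p →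
      FollowsMaker q σ p → potential c q p ≤ (1 + r) ^ 2 * Fintype.card κ := by
  choose σ hσ using exists_minimal_gain X c q
  refine ⟨σ, fun h _ hlt _ => ?_, fun p hp hf => ?_⟩
  · have := hσ h (exists_mem_notMem hlt)
    exact ⟨this.1, this.2.1⟩
  have hc1 : ∀ k e, |c k e| ≤ 1 := fun k e => (hc k e).trans hr
  have hN : (0 : ℝ) ≤ Fintype.card κ := by positivity
  have h0 : potential c q [] = Fintype.card κ := by simp [potential, weight]
  have hstep : ∀ i < p.length, potential c q (p.take (i + 1)) ≤
      (1 + r) * potential c q (p.take i) := by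
    intro i hi
    rw [List.take_succ_eq_append_getElem hi]
    exact potential_append_le hr hc _ _ _
  have hfree : ∀ i j (hj : j < p.length), i ≤ j → p[j] ∉ p.take i := by
    intro i j hj hij hmem
    obtain ⟨m, hm, hmj⟩ := List.mem_take_iff_getElem.mp hmem
    have := (hp.1.1.getElem_inj_iff).mp hmj
    omega
  have hround : ∀ i, i + 1 < p.length → q.turn i = MBPlayer.maker →
      potential c q (p.take (i + 2)) ≤ potential c q (p.take i) := by
    intro i hi hq
    have hi' : i < p.length := by omega
    rw [List.take_succ_eq_append_getElem hi, List.take_succ_eq_append_getElem hi']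
    refine potential_append_append_le hc1 hcc ?_ ?_
    · rwa [List.length_take, min_eq_left hi'.le]
    · have hmem : ∀ j (hj : j < p.length), p[j] ∈ X := fun j hj => hp.1.2 _ (List.getElem_mem hj)
      -- Breaker's reply was still free when Maker moved, so her minimal choice is compared with it.
      rw [hf i hi' hq]
      exact (hσ (p.take i) ⟨p[i], hmem i hi', hfree i i hi' le_rfl⟩).2.2 _ (hmem _ hi)
        (hfree _ _ hi (by omega))
  -- On Maker's turn, only an opening move by Breaker can be unpaired. On Breaker's turn, Maker's
  -- latest move may be a second one.
  have hmain : ∀ i ≤ p.length,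
      (q.turn i = MBPlayer.maker → potential c q (p.take i) ≤ (1 + r) * Fintype.card κ) ∧
      potential c q (p.take i) ≤ (1 + r) ^ 2 * Fintype.card κ := by
    intro i
    induction i using Nat.strong_induction_on with
    | _ i ih =>
    intro hi
    have hup : (1 + r) * (Fintype.card κ : ℝ) ≤ (1 + r) ^ 2 * Fintype.card κ := by
      have := mul_nonneg (mul_nonneg (by linarith : 0 ≤ 1 + r) hr0) hN
      nlinarith
    have hlow : (Fintype.card κ : ℝ) ≤ (1 + r) * Fintype.card κ := by
      nlinarith [mul_nonneg hr0 hN]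
    rcases i with _ | _ | i
    · rw [List.take_zero, h0]
      exact ⟨fun _ => hlow, hlow.trans hup⟩
    · have := hstep 0 hi
      rw [List.take_zero, h0] at this
      exact ⟨fun _ => this, this.trans hup⟩
    · cases hq : q.turn i with
      | maker =>
        have h1 := (hround i hi hq).trans ((ih i (by omega) (by omega)).1 hq)
        exact ⟨fun _ => h1, h1.trans hup⟩
      | breaker =>
        refine ⟨fun h => ?_, ?_⟩
        · simp [MBPlayer.turn, hq, MBPlayer.other] at h
        · have h1 : q.turn (i + 1) = MBPlayer.maker := by
            simp [MBPlayer.turn, hq, MBPlayer.other]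
          have h2 := (ih (i + 1) (by omega) (by omega)).1 h1
          have h3 := hstep (i + 1) hi
          nlinarith
  simpa using (hmain p.length le_rfl).2

end Potential

/-! ### From potential to discrepancy -/

theorem exp_sub_sq_le {x : ℝ} (hx : |x| ≤ 1 / 2) : Real.exp (x - x ^ 2) ≤ 1 + x := by
  obtain ⟨h1, h2⟩ := abs_le.mp hx
  rw [← neg_sub (x ^ 2) x, Real.exp_neg, inv_le_iff_one_le_mul₀ (Real.exp_pos _)]
  rcases le_total 0 x with h | h
  · have h3 : 1 - x + x ^ 2 ≤ Real.exp (x ^ 2 - x) := by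
      linarith [Real.add_one_le_exp (x ^ 2 - x)]
    nlinarith [mul_le_mul_of_nonneg_left h3 (by linarith : 0 ≤ 1 + x), pow_nonneg h 3]
  · have h3 := Real.quadratic_le_exp_of_nonneg (by nlinarith : 0 ≤ x ^ 2 - x)
    have h4 : 0 ≤ (1 + x) * (1 - x) ^ 2 + 2 * x := by
      nlinarith [mul_nonneg (by linarith : 0 ≤ x + 1 / 2) (sq_nonneg (1 - x)), sq_nonneg (1 + x)]
    nlinarith [mul_le_mul_of_nonneg_left h3 (by linarith : 0 ≤ 1 + x),
      mul_nonneg (sq_nonneg x) h4]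

theorem exp_le_prod_one_add {X : Finset E} {g : E → ℝ} {r : ℝ} (hr : r ≤ 1 / 2)
    (hg : ∀ e, |g e| ≤ r) :
    Real.exp (∑ e ∈ X, g e - r ^ 2 * X.card) ≤ ∏ e ∈ X, (1 + g e) := by
  have h : ∑ e ∈ X, g e - r ^ 2 * X.card = ∑ e ∈ X, (g e - r ^ 2) := by
    rw [Finset.sum_sub_distrib, Finset.sum_const, nsmul_eq_mul, mul_comm]
  rw [h, Real.exp_sum]
  refine Finset.prod_le_prod (fun _ _ => (Real.exp_pos _).le) fun e _ => ?_
  refine le_trans (Real.exp_le_exp.mpr ?_) (exp_sub_sq_le ((hg e).trans hr))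
  have := sq_le_sq' (by linarith [(abs_le.mp (hg e)).1]) (abs_le.mp (hg e)).2
  linarith

theorem MakerCanEnsure.mono {X : Finset E} {q : MBPlayer} {P Q : Set E → Prop}
    (h : MakerCanEnsure X q P) (hPQ : ∀ M, P M → Q M) : MakerCanEnsure X q Q := by
  obtain ⟨σ, hσ, hP⟩ := h
  exact ⟨σ, hσ, fun p hp hf => hPQ _ (hP p hp hf)⟩

open Classical in
/-- Maker can claim about half of every set of a finite family of subsets of the board. -/
theorem makerCanEnsure_discrepancy [Nonempty E] {ι : Type*} [Fintype ι] (X : Finset E)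
    (q : MBPlayer) (S : ι → Finset E) (hS : ∀ k, S k ⊆ X) {r : ℝ} (hr0 : 0 < r)
    (hr : r ≤ 1 / 2) :
    MakerCanEnsure X q (fun M =>
      M ⊆ X ∧ (X.filter (· ∈ M)).card = (X.card + if q = MBPlayer.maker then 1 else 0) / 2 ∧
      ∀ k, |2 * (((S k).filter (· ∈ M)).card : ℝ) - (S k).card| ≤
        Real.log (8 * Fintype.card ι) / r + r * X.card) := by
  -- The two signs give the upper and lower bounds. Each function has constant sign, as `hcc` needs.
  let c : ι × Bool → E → ℝ := fun k e =>
    (if k.2 then r else -r) * (if e ∈ S k.1 then 1 else 0)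
  have hc : ∀ k e, |c k e| ≤ r := by
    rintro ⟨k, b⟩ e
    by_cases he : e ∈ S k <;> cases b <;> simp [c, he, abs_of_pos hr0, hr0.le]
  have hcc : ∀ k e f, 0 ≤ c k e * c k f := by
    rintro ⟨k, b⟩ e f
    by_cases he : e ∈ S k <;> by_cases hf : f ∈ S k <;> cases b <;>
      simp [c, he, hf, mul_self_nonneg]
  obtain ⟨σ, hσ, hpot⟩ := makerCanEnsure_potential_le X q hr0.le (by linarith) hc hcc
  refine ⟨σ, hσ, fun p hp hf => ?_⟩
  have hpX : p.toFinset = X := by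
    ext e
    rw [List.mem_toFinset]
    exact ⟨hp.1.2 e, hp.2 e⟩
  have hlen : p.length = X.card := by rw [← hpX, List.toFinset_card_of_nodup hp.1.1]
  refine ⟨fun e he => hp.1.2 e (mem_of_mem_makerSet he), ?_, fun k => ?_⟩
  · have := card_filter_makerSet q p hp.1.1
    rwa [hpX, hlen] at this
  set M := makerSet q p
  let s : E → ℝ := fun e => if e ∈ M then 1 else -1
  have hsum : ∑ e ∈ X, s e * (if e ∈ S k then (1 : ℝ) else 0) =
      2 * (((S k).filter (· ∈ M)).card : ℝ) - (S k).card := by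
    simp only [mul_ite, mul_one, mul_zero]
    rw [← Finset.sum_filter, Finset.filter_mem_eq_inter, Finset.inter_eq_right.mpr (hS k)]
    have : ∀ e, s e = 2 * (if e ∈ M then 1 else 0) - 1 := by
      intro e
      by_cases he : e ∈ M <;> simp [s, he]
      norm_num
    simp only [this]
    rw [Finset.sum_sub_distrib, ← Finset.mul_sum, Finset.sum_boole]
    simp
  have hcard : 0 < Fintype.card ι := Fintype.card_pos_iff.mpr ⟨k⟩
  have hbound : ∀ b, ∑ e ∈ X, s e * c (k, b) e - r ^ 2 * X.card ≤
      Real.log (8 * Fintype.card ι) := by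
    intro b
    have hg : ∀ e, |s e * c (k, b) e| ≤ r := by
      intro e
      rw [abs_mul]
      have : |s e| = 1 := by by_cases he : e ∈ M <;> simp [s, he]
      rw [this, one_mul]
      exact hc _ _
    rw [Real.le_log_iff_exp_le (by positivity)]
    refine (exp_le_prod_one_add hr hg).trans ?_
    have h1 : ∏ e ∈ X, (1 + s e * c (k, b) e) = weight (c (k, b)) q p := by
      rw [weight_eq_prod _ _ _ hp.1.1, hpX]
    rw [h1]
    have h2 : weight (c (k, b)) q p ≤ potential c q p :=
      Finset.single_le_sum (f := fun k => weight (c k) q p)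
        (fun k _ => weight_nonneg (fun e => (hc k e).trans (by linarith)) q p)
        (Finset.mem_univ _)
    refine (h2.trans (hpot p hp hf)).trans ?_
    rw [Fintype.card_prod, Fintype.card_bool]
    push_cast
    -- The 8 is this 4 times the two signs.
    have h3 : (1 + r) ^ 2 ≤ 4 := by nlinarith
    have h4 : (0 : ℝ) ≤ Fintype.card ι := by positivity
    nlinarith
  have hlin : ∀ b : Bool, ∑ e ∈ X, s e * c (k, b) e = (if b then r else -r) *
      (2 * (((S k).filter (· ∈ M)).card : ℝ) - (S k).card) := by
    intro b
    rw [← hsum, Finset.mul_sum]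
    refine Finset.sum_congr rfl fun e _ => ?_
    simp only [c]
    ring
  have ht := hbound true
  have hf' := hbound false
  rw [hlin] at ht hf'
  simp only [if_true, Bool.false_eq_true, if_false] at ht hf'
  have key : ∀ x : ℝ, r * x - r ^ 2 * X.card ≤ Real.log (8 * Fintype.card ι) →
      x ≤ Real.log (8 * Fintype.card ι) / r + r * X.card := by
    intro x hx
    have : x - r * X.card ≤ Real.log (8 * Fintype.card ι) / r := by
      rw [le_div_iff₀ hr0]
      nlinarith
    linarith
  rw [abs_le']
  exact ⟨key _ ht, key _ (by linarith)⟩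

end MakerBreaker

/-! ### Edge sets and densities -/

namespace RegularPair

open Classical in
/-- The set of the edges between two sets of vertices. -/
noncomputable def edgesBetween {V : Type*} (G : SimpleGraph V) (X Y : Finset V) :
    Finset (Sym2 V) :=
  (G.interedges X Y).image fun a => s(a.1, a.2)

-- Disjointness rules out that both orientations of an edge occur in `T`.
open Classical in
theorem card_image_mk_of_disjoint {V : Type*} {X Y : Finset V} (hXY : Disjoint X Y)
    {T : Finset (V × V)} (hT : T ⊆ X ×ˢ Y) :
    (T.image fun a => s(a.1, a.2)).card = T.card := by
  refine Finset.card_image_of_injOn ?_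
  rintro ⟨a, b⟩ hab ⟨a', b'⟩ hab' h
  have h1 := Finset.mem_product.mp (hT hab)
  have h2 := Finset.mem_product.mp (hT hab')
  rcases Sym2.eq_iff.mp h with ⟨h3, h4⟩ | ⟨h3, h4⟩
  · exact Prod.ext h3 h4
  · exact absurd h2.2 (Finset.disjoint_left.mp hXY (h3 ▸ h1.1))

open Classical in
theorem density_eq {V : Type*} (G : SimpleGraph V) {A B : Finset V} (hAB : Disjoint A B) :
    density G A B = ((edgesBetween G A B).card : ℝ) / (A.card * B.card) := by
  rw [edgesBetween, SimpleGraph.interedges, Rel.interedges,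
    card_image_mk_of_disjoint hAB (Finset.filter_subset _ _), density, SimpleGraph.edgeDensity_def]
  push_cast
  rfl

open Classical in
theorem filter_edgesBetween {V : Type*} (G : SimpleGraph V) (X Y : Finset V)
    {M : Set (Sym2 V)} (hM : M ⊆ G.edgeSet) :
    (edgesBetween G X Y).filter (· ∈ M) = edgesBetween (SimpleGraph.fromEdgeSet M) X Y := by
  ext e
  simp only [edgesBetween, Finset.mem_filter, Finset.mem_image, SimpleGraph.mem_interedges_iff,
    SimpleGraph.fromEdgeSet_adj]
  constructor
  · rintro ⟨⟨a, ⟨h1, h2, h3⟩, rfl⟩, h4⟩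
    exact ⟨a, ⟨h1, h2, h4, h3.ne⟩, rfl⟩
  · rintro ⟨a, ⟨h1, h2, h3, -⟩, rfl⟩
    exact ⟨⟨a, ⟨h1, h2, hM h3⟩, rfl⟩, h3⟩

theorem edgesBetween_subset {V : Type*} [Fintype V] [DecidableEq V] (G : SimpleGraph V)
    [DecidableRel G.Adj] (X Y : Finset V) : edgesBetween G X Y ⊆ G.edgeFinset := by
  intro e he
  simp only [edgesBetween, Finset.mem_image, SimpleGraph.mem_interedges_iff] at he
  obtain ⟨a, ⟨-, -, h⟩, rfl⟩ := he
  rw [SimpleGraph.mem_edgeFinset]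
  exact h

theorem edgesBetween_eq_edgeFinset {V : Type*} [Fintype V] [DecidableEq V] {G : SimpleGraph V}
    [DecidableRel G.Adj] {A B : Finset V} (h : G.IsBipartiteWith (A : Set V) (B : Set V)) :
    edgesBetween G A B = G.edgeFinset := by
  refine (edgesBetween_subset G A B).antisymm fun e he => ?_
  rw [SimpleGraph.mem_edgeFinset] at he
  induction e using Sym2.ind with
  | _ x y =>
  have hxy : G.Adj x y := he
  simp only [edgesBetween, Finset.mem_image, SimpleGraph.mem_interedges_iff]
  rcases h.mem_of_adj hxy with ⟨h1, h2⟩ | ⟨h1, h2⟩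
  · exact ⟨(x, y), ⟨h1, h2, hxy⟩, rfl⟩
  · exact ⟨(y, x), ⟨h2, h1, hxy.symm⟩, Sym2.eq_swap⟩

theorem log_eight_mul_card_le {V : Type*} [Fintype V] [DecidableEq V] {n : ℕ}
    (hV : Fintype.card V = 2 * n) :
    Real.log (8 * Fintype.card (Finset V × Finset V)) ≤ 3 + 4 * n := by
  have h : (8 * Fintype.card (Finset V × Finset V) : ℝ) = 2 ^ (3 + 4 * n) := by
    rw [Fintype.card_prod, Fintype.card_finset, hV]
    push_cast
    ring
  rw [h, Real.log_pow]
  push_cast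
  have := Real.log_two_lt_d9
  have hn : (0 : ℝ) ≤ n := by positivity
  nlinarith

end RegularPair

/-! ### The lemma on regular pairs -/

open RegularPair MakerBreaker in
theorem lemma5p3 (ε α : ℝ) (hε : 0 < ε) (hεα : ε < α) (hα : α < 1) (h8 : 8 * ε < α) :
    ∃ n₀ : ℕ, ∀ n : ℕ, n₀ ≤ n →
      ∀ (V : Type*) [Fintype V] [DecidableEq V] (G : SimpleGraph V) [DecidableRel G.Adj]
        (A B : Finset V),
        A ∪ B = Finset.univ → G.IsBipartiteWith (A : Set V) (B : Set V) →
        A.card = n → B.card = n →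
        RegularPair.IsEpsRegular G ε A B → RegularPair.density G A B = α →
        ∀ first : MBPlayer,
          MakerBreaker.MakerCanEnsure G.edgeFinset first (fun M : Set (Sym2 V) =>
            RegularPair.IsEpsRegular (SimpleGraph.fromEdgeSet M) (4 * ε) A B ∧
            (Even G.edgeFinset.card →
              RegularPair.density (SimpleGraph.fromEdgeSet M) A B = α / 2) ∧
            |RegularPair.density (SimpleGraph.fromEdgeSet M) A B - α / 2| ≤ 1 / (2 * (n : ℝ) ^ 2) ∧
            (first = MBPlayer.maker →
              α / 2 ≤ RegularPair.density (SimpleGraph.fromEdgeSet M) A B)) := by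
  classical
  -- The logarithm is at most `7 * n`; this threshold makes its share of the error at most `24 * ε ^
  -- 3 * n ^ 2`.
  obtain ⟨N, hN⟩ := exists_nat_ge (7 / (8 * ε ^ 3) / (24 * ε ^ 3))
  refine ⟨N + 1, fun n hn V _ _ G _ A B hAB hG hA hB hreg hdens first => ?_⟩
  have hn1 : (1 : ℝ) ≤ n := by exact_mod_cast (by omega : 1 ≤ n)
  have hNn : (N : ℝ) ≤ n := by exact_mod_cast (by omega : N ≤ n)
  have hdisj : Disjoint A B := Finset.disjoint_coe.mp hG.disjoint
  have hV : Fintype.card V = 2 * n := by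
    rw [← Finset.card_univ, ← hAB, Finset.card_union_of_disjoint hdisj, hA, hB, two_mul]
  have hVne : Nonempty V := Fintype.card_pos_iff.mp (by omega)
  have : Nonempty (Sym2 V) := hVne.map fun v => s(v, v)
  have hε3 : 0 < ε ^ 3 := by positivity
  have hr : 8 * ε ^ 3 ≤ 1 / 2 := by
    have : ε ^ 3 ≤ (1 / 8) ^ 3 := pow_le_pow_left₀ hε.le (by linarith) 3
    linarith
  have hE : (G.edgeFinset.card : ℝ) = α * n ^ 2 := by
    rw [← hdens, density_eq G hdisj, hA, hB, edgesBetween_eq_edgeFinset hG]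
    field_simp
  refine (makerCanEnsure_discrepancy G.edgeFinset first
    (fun k : Finset V × Finset V => edgesBetween G k.1 k.2)
    (fun k => edgesBetween_subset G k.1 k.2) (by positivity) hr).mono ?_
  rintro M ⟨hMG, hMcard, hM⟩
  rw [SimpleGraph.coe_edgeFinset] at hMG
  -- The bound equals `2 * ε * (4 * ε * n) ^ 2`, hence is at most `2 * ε * |X| * |Y|` on large
  -- pairs.
  have herr : Real.log (8 * Fintype.card (Finset V × Finset V)) / (8 * ε ^ 3) +
      8 * ε ^ 3 * G.edgeFinset.card ≤ 32 * ε ^ 3 * n ^ 2 := by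
    have h1 : Real.log (8 * Fintype.card (Finset V × Finset V)) / (8 * ε ^ 3) ≤
        7 / (8 * ε ^ 3) * n := by
      rw [div_mul_eq_mul_div]
      refine div_le_div_of_nonneg_right ?_ (by positivity)
      linarith [log_eight_mul_card_le hV]
    have h2 : 7 / (8 * ε ^ 3) ≤ n * (24 * ε ^ 3) :=
      (div_le_iff₀ (by positivity)).mp (hN.trans hNn)
    have h3 : 7 / (8 * ε ^ 3) * n ≤ n * (24 * ε ^ 3) * n := by gcongr
    have h4 : 8 * ε ^ 3 * G.edgeFinset.card ≤ 8 * ε ^ 3 * n ^ 2 := by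
      rw [hE]
      gcongr
      nlinarith [sq_nonneg (n : ℝ)]
    nlinarith
  have hclose : ∀ X ⊆ A, ∀ Y ⊆ B, 4 * ε * n ≤ X.card → 4 * ε * n ≤ Y.card →
      |density (SimpleGraph.fromEdgeSet M) X Y - density G X Y / 2| ≤ ε := by
    intro X hX Y hY hXc hYc
    have hXY : Disjoint X Y := hdisj.mono hX hY
    have h1 := (hM (X, Y)).trans herr
    rw [filter_edgesBetween G X Y hMG] at h1
    have hpos : 0 < 4 * ε * n := by positivity
    have hX0 : (0 : ℝ) < X.card := hpos.trans_le hXc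
    have hY0 : (0 : ℝ) < Y.card := hpos.trans_le hYc
    have h2 : (4 * ε * n) * (4 * ε * n) ≤ (X.card : ℝ) * Y.card := by gcongr
    rw [density_eq _ hXY, density_eq _ hXY, div_div, mul_comm _ (2 : ℝ), ← mul_div_mul_left _ _ two_ne_zero,
      ← sub_div, abs_div, abs_of_pos (a := 2 * ((X.card : ℝ) * Y.card)) (by positivity),
      div_le_iff₀ (by positivity)]
    refine h1.trans ?_
    nlinarith [mul_le_mul_of_nonneg_left h2 hε.le]
  have hDM : density (SimpleGraph.fromEdgeSet M) A B =
      (((G.edgeFinset.card + if first = MBPlayer.maker then 1 else 0) / 2 : ℕ) : ℝ) / n ^ 2 := by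
    rw [density_eq _ hdisj, hA, hB, ← hMcard, ← filter_edgesBetween G A B hMG,
      edgesBetween_eq_edgeFinset hG, sq]
  have hα2 : α / 2 = (G.edgeFinset.card : ℝ) / 2 / n ^ 2 := by
    rw [hE]
    field_simp
  refine ⟨fun X hX Y hY hXc hYc => ?_, fun heven => ?_, ?_, fun hfirst => ?_⟩
  · rw [hA] at hXc
    rw [hB] at hYc
    have hle : 4 * ε * n ≤ n := by nlinarith
    have h1 := hclose X hX Y hY hXc hYc
    have h2 := hclose A subset_rfl B subset_rfl (by rwa [hA]) (by rwa [hB])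
    have hεn : 0 ≤ ε * n := by positivity
    have h3 := hreg X hX Y hY (by rw [hA]; linarith) (by rw [hB]; linarith)
    rw [abs_le] at h1 h2 h3 ⊢
    -- The errors add up to `ε + ε / 2 + ε`, below `4 * ε`.
    constructor <;> linarith
  · rw [hDM, hα2]
    obtain ⟨m, hm⟩ := heven
    have : (G.edgeFinset.card + if first = MBPlayer.maker then 1 else 0) / 2 = m := by
      split_ifs <;> omega
    rw [this, hm]
    push_cast
    ring
  · rw [hDM, hα2, ← sub_div, abs_div, abs_of_pos (a := (n : ℝ) ^ 2) (by positivity), ← div_div]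
    refine div_le_div_of_nonneg_right ?_ (by positivity)
    set m := (G.edgeFinset.card + if first = MBPlayer.maker then 1 else 0) / 2 with hm
    have h1 : 2 * m ≤ G.edgeFinset.card + 1 := by rw [hm]; split_ifs <;> omega
    have h2 : G.edgeFinset.card ≤ 2 * m + 1 := by rw [hm]; split_ifs <;> omega
    have h1' : (2 * m : ℝ) ≤ G.edgeFinset.card + 1 := by exact_mod_cast h1
    have h2' : (G.edgeFinset.card : ℝ) ≤ 2 * m + 1 := by exact_mod_cast h2
    rw [abs_le]
    constructor <;> linarith
  · rw [hDM, hα2, if_pos hfirst]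
    refine div_le_div_of_nonneg_right ?_ (by positivity)
    have h1 : G.edgeFinset.card ≤ 2 * ((G.edgeFinset.card + 1) / 2) := by omega
    have h1' : (G.edgeFinset.card : ℝ) ≤ 2 * ((G.edgeFinset.card + 1) / 2 : ℕ) := by
      exact_mod_cast h1
    linarith
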